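/- **Setting.** For a two-qubit state $\rho$ on $A\otimes B$ let $t_{ij}=\mathrm{Tr}(\rho\,\sigma_i\otimes\sigma_j)$, $i,j\in\{x,y,z\}$, be its correlation matrix, and let $\delta_1\ge\delta_2$ be the two largest eigenvalues of $\sqrt{t^{\dagger}t}$. For $r\in\mathbb R^3$ put $\sigma_r=r_1\sigma_x+r_2\sigma_y+r_3\sigma_z$, and let $|\psi\rangle=\frac1{\sqrt2}(|00\rangle+|11\rangle)$. *Sequential measurements on $A_1$'s side.* Fix orthonormal $u,v\in\mathbb R^3$ with $tt^{T}u=\delta_1^2u$ and $tt^{T}v=\delta_2^2v$ (the local Bloch axes of $A_1$ in which $\rho$ is brought to canonical form; if $t$ is diagonal with its two largest entries in absolute value in the $z$ and $x$ places, one may take $\sigma_u=\sigma_z$, $\sigma_v=\sigma_x$), an angle $\theta\in(0,\frac\pi4]$ and sharpness parameters $\gamma_k\in(0,1)$. On input $x\in\{0,1\}$ the $k$-th party on $A_1$'s side performs the two-outcome POVM $$A^{(k)}_{0|x}=\tfrac12\bigl(I+\cos\theta\,\sigma_u+(-1)^x\gamma_k\sin\theta\,\sigma_v\bigr),\qquad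 A^{(k)}_{1|x}=I-A^{(k)}_{0|x}.$$ Averaging over uniform inputs and over the outcomes gives $\rho^{(1)}=\rho$ and $$\rho^{(k+1)}=\tfrac12\sum_{a,x}\bigl(\sqrt{A^{(k)}_{a|x}}\otimes I\bigr)\rho^{(k)}\bigl(\sqrt{A^{(k)}_{a|x}}\otimes I\bigr).$$ *Star network.* There are $n$ outer parties $A_1,\dots,A_n$ and a central party $B$; source $i$ distributes $\rho_{A_iB}$ to $A_i$ and $B$. Two-outcome measurements with binary inputs ($B$ measures its $n$ qubits jointly) give, by Born's rule, correlations $p(a_1,\dots,a_n,b\,|\,x_1,\dots,x_n,y)$. They are $n$-local if $$p(\{a_i\},b\,|\,\{x_i\},y)=\int\Bigl(\prod_{i=1}^n d\mu_i(\lambda_i)\,p(a_i|x_i,\lambda_i)\Bigr)\,p(b|y,\lambda_1,\dots,\lambda_n)$$ for probability measures $\mu_1,\dots,\mu_n$ and response functions. With $\langle A^1_{x_1}\cdots A^n_{x_n}B_y\rangle=\sum_{a_1,\dots,a_n,b}(-1)^{b+\sum_ia_i}\,p(\{a_i\},b|\{x_i\},y)$ put $$I=\frac1{2^n}\sum_{x_1,\dots,x_n}\langle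 A^1_{x_1}\cdots A^n_{x_n}B_0\rangle,\qquad J=\frac1{2^n}\sum_{x_1,\dots,x_n}(-1)^{\sum_ix_i}\langle A^1_{x_1}\cdots A^n_{x_n}B_1\rangle .$$ The $n$-locality inequality is $|I|^{1/n}+|J|^{1/n}\le1$. **Theorem 5.** Let $\rho_{A_1B}$ be a two-qubit state that is either an entangled pure state, or a (mixed) state with $\delta_1=1$ and $\delta_2>0$. Axes $u,v$ as above exist; and for all such axes, every $\theta\in(0,\frac\pi4]$ and every $m\in\mathbb N$ there are $\gamma_1,\gamma_2,\dots\in(0,1)$ such that for every $n\ge1$ and every $k=1,\dots,m$ (in particular for $k=m$, after $m-1$ sequential POVMs on $A_1$'s side) the network state $$\rho_{A_1B}^{(k)}\otimes|\psi\rangle\langle\psi|^{\otimes(n-1)}$$ is network nonlocal: for suitable two-outcome measurements of $A_1,\dots,A_n$ and $B$, the resulting correlations satisfy $|I|^{1/n}+|J|^{1/n}>1$ and are not $n$-local. -/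

import Mathlib

open Matrix MeasureTheory
open scoped Kronecker ComplexOrder MatrixOrder

noncomputable section

namespace StarNetwork

/-! ### Two-qubit states -/

/-- Operators on one qubit. -/
abbrev QubitOp : Type := Matrix (Fin 2) (Fin 2) ℂ

/-- Operators on two qubits; the first index belongs to the outer party `A`, the second to the
central party `B`. -/
abbrev TwoQubitOp : Type := Matrix (Fin 2 × Fin 2) (Fin 2 × Fin 2) ℂ

/-- Density matrices: positive semidefinite with trace one. -/
def IsState {d : Type*} [Fintype d] (ρ : Matrix d d ℂ) : Prop :=
  ρ.PosSemidef ∧ ρ.trace = 1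

/-- A pure state: the rank one operator `|φ⟩⟨φ|` of a unit vector `φ`. -/
def IsPure {d : Type*} [Fintype d] (ρ : Matrix d d ℂ) : Prop :=
  ∃ φ : d → ℂ, star φ ⬝ᵥ φ = 1 ∧ ρ = vecMulVec φ (star φ)

/-- A two-qubit operator is separable if it is a finite convex combination of product states. -/
def IsSeparable (ρ : TwoQubitOp) : Prop :=
  ∃ (N : ℕ) (w : Fin N → ℝ) (α β : Fin N → QubitOp),
    (∀ i, 0 ≤ w i) ∧ ∑ i, w i = 1 ∧ (∀ i, IsState (α i)) ∧ (∀ i, IsState (β i)) ∧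
      ρ = ∑ i, (w i : ℂ) • (α i ⊗ₖ β i)

/-- A state is entangled if it is not separable. -/
def IsEntangled (ρ : TwoQubitOp) : Prop := ¬ IsSeparable ρ

/-- The vector `(|00⟩ + |11⟩) / √2`. -/
def bellVec : Fin 2 × Fin 2 → ℂ := fun i => if i.1 = i.2 then ((1 / √2 : ℝ) : ℂ) else 0

/-- The maximally entangled state `|ψ⟩⟨ψ|`. -/
def bellState : TwoQubitOp := vecMulVec bellVec (star bellVec)

/-- The Pauli matrices `σ_x, σ_y, σ_z`. -/
def pauli : Fin 3 → QubitOp :=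
  ![!![0, 1; 1, 0], !![0, -Complex.I; Complex.I, 0], !![1, 0; 0, -1]]

/-- `σ_r = r₁ σ_x + r₂ σ_y + r₃ σ_z`. -/
def sigma (r : Fin 3 → ℝ) : QubitOp := ∑ i, (r i : ℂ) • pauli i

/-- The correlation matrix `t_ij = Tr (ρ (σ_i ⊗ σ_j))`. -/
def corrMatrix (ρ : TwoQubitOp) : Matrix (Fin 3) (Fin 3) ℝ :=
  Matrix.of fun i j => ((ρ * (pauli i ⊗ₖ pauli j)).trace).re

/-- The singular values of the correlation matrix `t`, i.e. the eigenvalues of `√(t† t)`, in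
decreasing order and numbered from `0`: `delta ρ 0` and `delta ρ 1` are the two largest ones,
`δ₁ ≥ δ₂`. -/
def delta (ρ : TwoQubitOp) (k : ℕ) : ℝ :=
  (Matrix.toEuclideanLin (corrMatrix ρ)).singularValues k

/-! ### Sequential measurements on one side -/

/-- Two-outcome POVMs. -/
def IsPOVM {d : Type*} [Fintype d] [DecidableEq d] (E : Fin 2 → Matrix d d ℂ) : Prop :=
  (∀ a, (E a).PosSemidef) ∧ ∑ a, E a = 1

/-- The POVMs (input `x`, outcome `a`) of an outer party with angle `θ` and sharpness `γ`, relative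
to the directions `u`, `v` on the Bloch sphere:
`A_{0|x} = (1 + cos θ σ_u + (-1)^x γ sin θ σ_v) / 2` and `A_{1|x} = 1 - A_{0|x}`. -/
def seqPOVM (u v : Fin 3 → ℝ) (θ γ : ℝ) (x a : Fin 2) : QubitOp :=
  (1 / 2 : ℂ) • (1 + (-1 : ℂ) ^ (a : ℕ) •
    (((Real.cos θ : ℝ) : ℂ) • sigma u +
      ((-1 : ℂ) ^ (x : ℕ) * ((γ * Real.sin θ : ℝ) : ℂ)) • sigma v))

/-- One step of the process: a measurement `E x a` on the first qubit, averaged over uniformly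
distributed inputs `x` and over the outcomes `a`:
`ρ ↦ (1/2) ∑_{a,x} (√E_{a|x} ⊗ 1) ρ (√E_{a|x} ⊗ 1)`. -/
def measureStep (E : Fin 2 → Fin 2 → QubitOp) (ρ : TwoQubitOp) : TwoQubitOp :=
  (1 / 2 : ℂ) • ∑ x, ∑ a,
    (CFC.sqrt (E x a) ⊗ₖ (1 : QubitOp)) * ρ * (CFC.sqrt (E x a) ⊗ₖ (1 : QubitOp))

/-- The state after the measurements of the parties `1, …, j`, where party `k` uses the POVMs
`E k`. In the usual numbering this is `ρ^(j+1)`, the state received by party `j + 1`. -/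
def stateAfter (E : ℕ → Fin 2 → Fin 2 → QubitOp) (ρ : TwoQubitOp) : ℕ → TwoQubitOp
  | 0 => ρ
  | j + 1 => measureStep (E (j + 1)) (stateAfter E ρ j)

/-- `u` and `v` are orthogonal unit vectors, and they are left singular vectors of the correlation
matrix `t` for its two largest singular values: `t tᵀ u = δ₁² u` and `t tᵀ v = δ₂² v`. -/
def IsCorrFrame (ρ : TwoQubitOp) (u v : Fin 3 → ℝ) : Prop :=
  u ⬝ᵥ u = 1 ∧ v ⬝ᵥ v = 1 ∧ u ⬝ᵥ v = 0 ∧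
    (corrMatrix ρ * (corrMatrix ρ)ᵀ) *ᵥ u = (delta ρ 0 ^ 2) • u ∧
    (corrMatrix ρ * (corrMatrix ρ)ᵀ) *ᵥ v = (delta ρ 1 ^ 2) • v

/-! ### The star network -/

/-- The states emitted by the `n` sources of the star: the first source emits `τ`, the other ones
emit `|ψ⟩⟨ψ|`. -/
def sources (n : ℕ) (τ : TwoQubitOp) : Fin n → TwoQubitOp :=
  fun i => if (i : ℕ) = 0 then τ else bellState

/-- The state `ρ_{A_1 B} ⊗ ⋯ ⊗ ρ_{A_n B}` of the network. -/
def networkState {n : ℕ} (ρ : Fin n → TwoQubitOp) :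
    Matrix (Fin n → Fin 2 × Fin 2) (Fin n → Fin 2 × Fin 2) ℂ :=
  Matrix.of fun f g => ∏ i, ρ i (f i) (g i)

/-- The operator `M_1 ⊗ ⋯ ⊗ M_n ⊗ N`, where `M_i` acts on the qubit of the outer party `A_i` and
`N` acts jointly on the `n` qubits of the central party. -/
def jointEffect {n : ℕ} (M : Fin n → QubitOp) (N : Matrix (Fin n → Fin 2) (Fin n → Fin 2) ℂ) :
    Matrix (Fin n → Fin 2 × Fin 2) (Fin n → Fin 2 × Fin 2) ℂ :=
  Matrix.of fun f g =>
    (∏ i, M i (f i).1 (g i).1) * N (fun i => (f i).2) (fun i => (g i).2)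

/-- Families `p a b x y = p({a_i}, b | {x_i}, y)` with binary inputs and outputs. -/
abbrev Behaviour (n : ℕ) : Type :=
  (Fin n → Fin 2) → Fin 2 → (Fin n → Fin 2) → Fin 2 → ℝ

/-- The correlations obtained from the network state by the measurements `A i x` (outer party `i`,
input `x`) and `B y` (central party, input `y`), by Born's rule. -/
def behaviour {n : ℕ} (ρ : Fin n → TwoQubitOp) (A : Fin n → Fin 2 → Fin 2 → QubitOp)
    (B : Fin 2 → Fin 2 → Matrix (Fin n → Fin 2) (Fin n → Fin 2) ℂ) : Behaviour n :=
  fun a b x y => ((networkState ρ * jointEffect (fun i => A i (x i) (a i)) (B y b)).trace).re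

/-- The correlator `⟨A_{x_1}^1 ⋯ A_{x_n}^n B_y⟩`. -/
def correlator {n : ℕ} (p : Behaviour n) (x : Fin n → Fin 2) (y : Fin 2) : ℝ :=
  ∑ a : Fin n → Fin 2, ∑ b : Fin 2, (-1 : ℝ) ^ ((b : ℕ) + ∑ i, (a i : ℕ)) * p a b x y

/-- `I = 2^{-n} ∑_x ⟨A_{x_1}^1 ⋯ A_{x_n}^n B_0⟩`. -/
def corrI {n : ℕ} (p : Behaviour n) : ℝ :=
  1 / 2 ^ n * ∑ x : Fin n → Fin 2, correlator p x 0

/-- `J = 2^{-n} ∑_x (-1)^{x_1 + ⋯ + x_n} ⟨A_{x_1}^1 ⋯ A_{x_n}^n B_1⟩`. -/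
def corrJ {n : ℕ} (p : Behaviour n) : ℝ :=
  1 / 2 ^ n * ∑ x : Fin n → Fin 2, (-1 : ℝ) ^ (∑ i, (x i : ℕ)) * correlator p x 1

/-- `|I|^{1/n} + |J|^{1/n}`, the left side of the `n`-locality inequality `… ≤ 1`. -/
def nStar {n : ℕ} (p : Behaviour n) : ℝ :=
  |corrI p| ^ (1 / n : ℝ) + |corrJ p| ^ (1 / n : ℝ)

/-- `n`-local correlations: independent hidden variables `λ_1, …, λ_n`, one for each source; the
outer party `i` responds to `x_i` and `λ_i`, the central party to `y` and all of the `λ_i`. -/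
def IsNLocal {n : ℕ} (p : Behaviour n) : Prop :=
  ∃ (L : Fin n → Type) (_ : ∀ i, MeasurableSpace (L i)) (μ : ∀ i, Measure (L i))
    (PA : ∀ i, Fin 2 → Fin 2 → L i → ℝ) (PB : Fin 2 → Fin 2 → (∀ i, L i) → ℝ),
    (∀ i, IsProbabilityMeasure (μ i)) ∧
    (∀ i a x, Measurable (PA i a x) ∧ ∀ l, 0 ≤ PA i a x l) ∧
    (∀ i x l, ∑ a, PA i a x l = 1) ∧
    (∀ b y, Measurable (PB b y) ∧ ∀ l, 0 ≤ PB b y l) ∧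
    (∀ y l, ∑ b, PB b y l = 1) ∧
    ∀ a b x y, p a b x y = ∫ l, (∏ i, PA i (a i) (x i) (l i)) * PB b y l ∂(Measure.pi μ)

/-- Network nonlocality of the star-network state with sources `ρ`, certified by the `n`-locality
inequality: for suitable two-outcome measurements of all parties, the resulting correlations
violate the inequality, and they admit no `n`-local hidden variable model. -/
def IsNetworkNonlocal {n : ℕ} (ρ : Fin n → TwoQubitOp) : Prop :=
  ∃ (A : Fin n → Fin 2 → Fin 2 → QubitOp)
    (B : Fin 2 → Fin 2 → Matrix (Fin n → Fin 2) (Fin n → Fin 2) ℂ),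
    (∀ i x, IsPOVM (A i x)) ∧ (∀ y, IsPOVM (B y)) ∧
      1 < nStar (behaviour ρ A B) ∧ ¬ IsNLocal (behaviour ρ A B)

end StarNetwork

end

noncomputable section

namespace StarNetwork

/-! ### The `n`-locality inequality -/

/-! Both hypotheses on the state enter only through `δ₁ ≥ 1` and `δ₂ > 0`. In the Heisenberg picture
every averaged measurement maps `σ_u` to `κ σ_u` and `σ_v` to `μ σ_v`, with `κ ≥ 1 - γ²` and `μ ≥
sin² θ` (`exists_dualStep_seqPOVM`). With one sharpness `γ` for all steps, the correlations along
the singular directions become `I = κ^(k-1) δ₁` and `J = μ^(k-1) δ₂`. For `k ≤ m` the first is at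
least `1 - mγ²`, while the second has the positive lower bound `(sin² θ)^m δ₂`, independent of `γ`.
A small `γ` therefore gives `I² + J² > 1` for all these `k` at once.

This condition suffices for every `n` (`isNetworkNonlocal_sources`). All parties measure freely
chosen projective observables, the central one a product of Pauli observables, so `I` and `J` of the
network factor over the sources. The first outer party uses observables in the plane of `σ_u`,
`σ_v`, rotated to make its two contributions sum to `√(I² + J²) > 1`; a common rotation at the Bell
pairs keeps the violation (`exists_angle_rpow`). Failure of `n`-locality then follows from the
inequality itself (`IsNLocal.nStar_le_one`): independence factors the hidden-variable bound and
AM-GM combines the factors.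

For an entangled pure state, `t tᵀ = C² + a aᵀ` with Bloch vector `a`, concurrence `C > 0` and `|a|²
+ C² = 1` (`corrMatrix_pure_mul_transpose`), so `1` is an eigenvalue and `t` is invertible; no
Schmidt decomposition is needed. -/

theorem sum_pow_mul_prod {R : Type*} [CommRing R] {n : ℕ} (s : R) (f : Fin n → Fin 2 → R) :
    ∑ x : Fin n → Fin 2, s ^ (∑ i, (x i : ℕ)) * ∏ i, f i (x i) = ∏ i, (f i 0 + s * f i 1) := by
  have h : ∀ i, f i 0 + s * f i 1 = ∑ j : Fin 2, s ^ (j : ℕ) * f i j := by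
    intro i; simp [Fin.sum_univ_two]
  simp_rw [h, Finset.prod_univ_sum, Fintype.piFinset_univ, Finset.prod_mul_distrib,
    Finset.prod_pow_eq_pow_sum]

theorem sum_outcomes_mul_prod {R : Type*} [CommRing R] {n : ℕ} (f : Fin n → Fin 2 → R)
    (g : Fin 2 → R) :
    ∑ a : Fin n → Fin 2, ∑ b : Fin 2,
      (-1 : R) ^ ((b : ℕ) + ∑ i, (a i : ℕ)) * ((∏ i, f i (a i)) * g b) =
    (∏ i, (f i 0 - f i 1)) * (g 0 - g 1) := by
  have h := sum_pow_mul_prod (-1 : R) f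
  simp only [neg_one_mul, ← sub_eq_add_neg] at h
  rw [← h, Finset.sum_mul]
  refine Finset.sum_congr rfl fun a _ => ?_
  rw [Fin.sum_univ_two]
  simp only [Fin.val_zero, Fin.val_one, pow_add]
  ring

/-- The common form of `corrI` and `corrJ`. -/
def signedCorr {n : ℕ} (s : ℝ) (y : Fin 2) (p : Behaviour n) : ℝ :=
  1 / 2 ^ n * ∑ x : Fin n → Fin 2, s ^ (∑ i, (x i : ℕ)) * correlator p x y

theorem corrI_eq_signedCorr {n : ℕ} (p : Behaviour n) : corrI p = signedCorr 1 0 p := by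
  simp [corrI, signedCorr]

theorem corrJ_eq_signedCorr {n : ℕ} (p : Behaviour n) : corrJ p = signedCorr (-1) 1 p := rfl

/-- AM-GM with weights `1/n`, applied to each product separately; the two arithmetic means add up to
at most one. -/
theorem prod_rpow_add_prod_rpow_le_one {n : ℕ} (hn : 1 ≤ n) (p q : Fin n → ℝ) (hp : ∀ i, 0 ≤ p i)
    (hq : ∀ i, 0 ≤ q i) (h : ∀ i, p i + q i ≤ 1) :
    (∏ i, p i) ^ (1 / n : ℝ) + (∏ i, q i) ^ (1 / n : ℝ) ≤ 1 := by
  have hn0 : (0 : ℝ) < n := by exact_mod_cast hn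
  have key : ∀ z : Fin n → ℝ, (∀ i, 0 ≤ z i) →
      (∏ i, z i) ^ (1 / n : ℝ) ≤ ∑ i, (1 / n : ℝ) * z i := by
    intro z hz
    rw [← Real.finsetProd_rpow _ _ fun i _ => hz i]
    refine Real.geom_mean_le_arith_mean_weighted _ _ _ (fun _ _ => by positivity) ?_ fun i _ => hz i
    simp [hn0.ne']
  calc _ ≤ ∑ i, (1 / n : ℝ) * p i + ∑ i, (1 / n : ℝ) * q i := add_le_add (key p hp) (key q hq)
    _ = ∑ i, (1 / n : ℝ) * (p i + q i) := by simp [mul_add, Finset.sum_add_distrib]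
    _ ≤ ∑ _i : Fin n, (1 / n : ℝ) * 1 :=
      Finset.sum_le_sum fun i _ => mul_le_mul_of_nonneg_left (h i) (by positivity)
    _ = 1 := by simp [hn0.ne']

theorem integrable_prod_mul {n : ℕ} {L : Fin n → Type} [∀ i, MeasurableSpace (L i)]
    (μ : ∀ i, Measure (L i)) [∀ i, IsProbabilityMeasure (μ i)] (f : ∀ i, L i → ℝ)
    (hf : ∀ i, Measurable (f i)) (hf1 : ∀ i l, |f i l| ≤ 1) (g : (∀ i, L i) → ℝ)
    (hg : Measurable g) (hg1 : ∀ l, |g l| ≤ 1) :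
    Integrable (fun l => (∏ i, f i (l i)) * g l) (Measure.pi μ) := by
  refine Integrable.of_bound (C := 1) (Measurable.aestronglyMeasurable ?_) (ae_of_all _ ?_)
  · exact (Finset.measurable_prod _ fun i _ => (hf i).comp (measurable_pi_apply i)).mul hg
  · intro l
    rw [Real.norm_eq_abs, abs_mul, Finset.abs_prod]
    exact mul_le_one₀ (Finset.prod_le_one (fun _ _ => abs_nonneg _) fun i _ => hf1 i _)
      (abs_nonneg _) (hg1 l)

theorem sum_outcomes_mul_integral {n : ℕ} {L : Fin n → Type} [∀ i, MeasurableSpace (L i)]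
    (μ : ∀ i, Measure (L i)) [∀ i, IsProbabilityMeasure (μ i)] (f : ∀ i, Fin 2 → L i → ℝ)
    (hf : ∀ i a, Measurable (f i a)) (hf1 : ∀ i a l, |f i a l| ≤ 1)
    (g : Fin 2 → (∀ i, L i) → ℝ) (hg : ∀ b, Measurable (g b)) (hg1 : ∀ b l, |g b l| ≤ 1) :
    ∑ a : Fin n → Fin 2, ∑ b : Fin 2, (-1 : ℝ) ^ ((b : ℕ) + ∑ i, (a i : ℕ)) *
        ∫ l, (∏ i, f i (a i) (l i)) * g b l ∂(Measure.pi μ) =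
      ∫ l, (∏ i, (f i 0 (l i) - f i 1 (l i))) * (g 0 l - g 1 l) ∂(Measure.pi μ) := by
  have hint : ∀ (a : Fin n → Fin 2) (b : Fin 2),
      Integrable (fun l => (-1 : ℝ) ^ ((b : ℕ) + ∑ i, (a i : ℕ)) *
        ((∏ i, f i (a i) (l i)) * g b l)) (Measure.pi μ) := fun a b =>
    (integrable_prod_mul μ (fun i => f i (a i)) (fun i => hf i _) (fun i => hf1 i _) _ (hg b)
      (hg1 b)).const_mul _
  calc _ = ∫ l, ∑ a : Fin n → Fin 2, ∑ b : Fin 2, (-1 : ℝ) ^ ((b : ℕ) + ∑ i, (a i : ℕ)) *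
        ((∏ i, f i (a i) (l i)) * g b l) ∂(Measure.pi μ) := by
        rw [integral_finsetSum _ fun a _ => integrable_finsetSum _ fun b _ => hint a b]
        refine Finset.sum_congr rfl fun a _ => ?_
        rw [integral_finsetSum _ fun b _ => hint a b]
        exact Finset.sum_congr rfl fun b _ => (integral_const_mul _ _).symm
    _ = _ := integral_congr_ae (ae_of_all _ fun l =>
        sum_outcomes_mul_prod (fun i a => f i a (l i)) (fun b => g b l))

/-- The central response is bounded by one and can be dropped, although it depends on all hidden
variables. What remains factors because the sources are independent. -/
theorem abs_integral_prod_mul_le {n : ℕ} {L : Fin n → Type} [∀ i, MeasurableSpace (L i)]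
    (μ : ∀ i, Measure (L i)) [∀ i, IsProbabilityMeasure (μ i)] (f : ∀ i, L i → ℝ)
    (hf : ∀ i, Measurable (f i)) (hf1 : ∀ i l, |f i l| ≤ 1) (g : (∀ i, L i) → ℝ)
    (hg : Measurable g) (hg1 : ∀ l, |g l| ≤ 1) :
    |∫ l, (∏ i, f i (l i)) * g l ∂(Measure.pi μ)| ≤ ∏ i, ∫ l, |f i l| ∂(μ i) := by
  have h1 := integrable_prod_mul μ f hf hf1 g hg hg1
  have h2 := integrable_prod_mul μ (fun i l => |f i l|) (fun i => (hf i).abs)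
    (by simpa using hf1) (fun _ => 1) measurable_const (by simp)
  rw [← integral_fintype_prod_eq_prod]
  refine (abs_integral_le_integral_abs).trans (integral_mono h1.abs (by simpa using h2) ?_)
  intro l
  simp only [abs_mul, Finset.abs_prod]
  exact mul_le_of_le_one_right (Finset.prod_nonneg fun _ _ => abs_nonneg _) (hg1 l)

/-- The `n`-locality inequality. -/
theorem IsNLocal.nStar_le_one {n : ℕ} (hn : 1 ≤ n) {p : Behaviour n} (h : IsNLocal p) :
    nStar p ≤ 1 := by
  obtain ⟨L, _, μ, PA, PB, _, hA, hA1, hB, hB1, hp⟩ := h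
  have hAle : ∀ i a x l, |PA i a x l| ≤ 1 := by
    intro i a x l
    have h0 := (hA i 0 x).2 l
    have h1 := (hA i 1 x).2 l
    have h2 := hA1 i x l
    rw [Fin.sum_univ_two] at h2
    fin_cases a <;> simp only [Fin.zero_eta, Fin.mk_one] <;> rw [abs_le] <;> constructor <;> linarith
  have hBle : ∀ b y l, |PB b y l| ≤ 1 := by
    intro b y l
    have h0 := (hB 0 y).2 l
    have h1 := (hB 1 y).2 l
    have h2 := hB1 y l
    rw [Fin.sum_univ_two] at h2
    fin_cases b <;> simp only [Fin.zero_eta, Fin.mk_one] <;> rw [abs_le] <;> constructor <;> linarith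
  set D : ∀ i, Fin 2 → L i → ℝ := fun i x l => PA i 0 x l - PA i 1 x l with hD
  set DB : Fin 2 → (∀ i, L i) → ℝ := fun y l => PB 0 y l - PB 1 y l with hDB
  have hDm : ∀ i x, Measurable (D i x) := fun i x => (hA i 0 x).1.sub (hA i 1 x).1
  have hDBm : ∀ y, Measurable (DB y) := fun y => (hB 0 y).1.sub (hB 1 y).1
  have hD1 : ∀ i x l, |D i x l| ≤ 1 := by
    intro i x l
    have h0 := (hA i 0 x).2 l
    have h1 := (hA i 1 x).2 l
    have h2 := hA1 i x l
    rw [Fin.sum_univ_two] at h2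
    simp only [hD]
    rw [abs_le]; constructor <;> linarith
  have hDB1 : ∀ y l, |DB y l| ≤ 1 := by
    intro y l
    have h0 := (hB 0 y).2 l
    have h1 := (hB 1 y).2 l
    have h2 := hB1 y l
    rw [Fin.sum_univ_two] at h2
    simp only [hDB]
    rw [abs_le]; constructor <;> linarith
  have hcorr : ∀ x y, correlator p x y = ∫ l, (∏ i, D i (x i) (l i)) * DB y l ∂(Measure.pi μ) := by
    intro x y
    simp_rw [correlator, hp]
    exact sum_outcomes_mul_integral μ (fun i a => PA i a (x i)) (fun i a => (hA i a _).1)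
      (fun i a => hAle i a _) (fun b => PB b y) (fun b => (hB b y).1) (fun b => hBle b y)
  -- The average over all settings moves inside the product, since each outer factor depends only on
  -- its own setting. The pair `s = 1, y = 0` yields `I`, and `s = -1, y = 1` yields `J`.
  have hs : ∀ s y, |s| = 1 →
      |signedCorr s y p| ≤ ∏ i, ∫ l, |(D i 0 l + s * D i 1 l) / 2| ∂(μ i) := by
    intro s y hs
    have hm : ∀ i, Measurable fun l => (D i 0 l + s * D i 1 l) / 2 := fun i =>
      ((hDm i 0).add ((hDm i 1).const_mul s)).div_const 2
    have hb : ∀ i l, |(D i 0 l + s * D i 1 l) / 2| ≤ 1 := by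
      intro i l
      rw [abs_div, abs_two, div_le_one two_pos]
      refine (abs_add_le _ _).trans ?_
      rw [abs_mul, hs]
      linarith [hD1 i 0 l, hD1 i 1 l]
    refine le_of_eq_of_le ?_ (abs_integral_prod_mul_le μ _ hm hb (DB y) (hDBm y) (hDB1 y))
    congr 1
    simp_rw [signedCorr, hcorr, ← integral_const_mul]
    rw [← integral_finsetSum, ← integral_const_mul]
    · refine integral_congr_ae (ae_of_all _ fun l => ?_)
      have := sum_pow_mul_prod s (fun i x => D i x (l i))
      simp only [Finset.prod_div_distrib, ← this, Finset.prod_const, Finset.card_univ,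
        Fintype.card_fin]
      simp only [← mul_assoc, ← Finset.sum_mul]
      ring
    · intro x _
      exact (integrable_prod_mul μ (fun i => D i (x i)) (fun i => hDm i _)
        (fun i => hD1 i _) _ (hDBm y) (hDB1 y)).const_mul _
  have hI := hs 1 0 (by simp)
  have hJ := hs (-1) 1 (by simp)
  rw [← corrI_eq_signedCorr] at hI
  rw [← corrJ_eq_signedCorr] at hJ
  have hint : ∀ s : ℝ, |s| = 1 → ∀ i, Integrable (fun l => |(D i 0 l + s * D i 1 l) / 2|) (μ i) := by
    intro s hs i
    refine Integrable.of_bound (C := 1) (Measurable.aestronglyMeasurable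
      (((hDm i 0).add ((hDm i 1).const_mul s)).div_const 2).abs) (ae_of_all _ fun l => ?_)
    rw [Real.norm_eq_abs, abs_abs, abs_div, abs_two, div_le_one two_pos]
    refine (abs_add_le _ _).trans ?_
    rw [abs_mul, hs]
    linarith [hD1 i 0 l, hD1 i 1 l]
  refine le_trans (add_le_add (Real.rpow_le_rpow (abs_nonneg _) hI (by positivity))
    (Real.rpow_le_rpow (abs_nonneg _) hJ (by positivity)))
    (prod_rpow_add_prod_rpow_le_one hn _ _ (fun i => integral_nonneg fun _ => abs_nonneg _)
      (fun i => integral_nonneg fun _ => abs_nonneg _) fun i => ?_)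
  -- Pointwise, `|a + b|/2 + |a - b|/2 = max |a| |b| ≤ 1`, which survives integration.
  rw [← integral_add (hint 1 (by simp) i) (hint (-1) (by simp) i)]
  calc _ ≤ ∫ _, (1 : ℝ) ∂(μ i) := by
        refine integral_mono ((hint 1 (by simp) i).add (hint (-1) (by simp) i))
          (integrable_const _) fun l => ?_
        have h0 := abs_le.mp (hD1 i 0 l)
        have h1 := abs_le.mp (hD1 i 1 l)
        simp only
        rcases abs_cases ((D i 0 l + 1 * D i 1 l) / 2) with ⟨e1, _⟩ | ⟨e1, _⟩ <;>
          rcases abs_cases ((D i 0 l + -1 * D i 1 l) / 2) with ⟨e2, _⟩ | ⟨e2, _⟩ <;>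
          rw [e1, e2] <;> linarith
    _ = 1 := by simp

/-- Rotating the settings of the other parties turns a violation with one source into a violation
with `n` sources. -/
theorem exists_angle_rpow {I J : ℝ} (hI : 0 < I) (hJ : 0 < J) (h : 1 < I + J) (n : ℕ) :
    ∃ c s : ℝ, 0 < c ∧ 0 < s ∧ c ^ 2 + s ^ 2 = 1 ∧
      1 < (I * c ^ n) ^ (1 / ((n + 1 : ℕ) : ℝ)) + (J * s ^ n) ^ (1 / ((n + 1 : ℕ) : ℝ)) := by
  set R := √(I ^ 2 + J ^ 2) with hR
  have hR2 : R ^ 2 = I ^ 2 + J ^ 2 := Real.sq_sqrt (by positivity)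
  have hR0 : 0 < R := Real.sqrt_pos.mpr (by positivity)
  have hRle : R < I + J := by nlinarith [mul_pos hI hJ]
  -- With this direction both roots acquire the same factor `R^(-n/(n+1))`, so the claim becomes
  -- `R^n < (I + J)^(n+1)`, which follows from `R < I + J` and `1 < I + J`.
  refine ⟨I / R, J / R, by positivity, by positivity, ?_, ?_⟩
  · rw [div_pow, div_pow, ← add_div, ← hR2, div_self (by positivity)]
  have key : ∀ z : ℝ, 0 < z → (z * (z / R) ^ n) ^ (1 / ((n + 1 : ℕ) : ℝ)) =
      z * (R ^ n)⁻¹ ^ (1 / ((n + 1 : ℕ) : ℝ)) := by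
    intro z hz
    have : z * (z / R) ^ n = z ^ (n + 1) * (R ^ n)⁻¹ := by
      rw [div_pow, pow_succ]; field_simp
    rw [this, Real.mul_rpow (by positivity) (by positivity), one_div,
      Real.pow_rpow_inv_natCast hz.le (by simp)]
  rw [key I hI, key J hJ, ← add_mul, Real.inv_rpow (by positivity), ← div_eq_mul_inv,
    one_lt_div (by positivity)]
  refine lt_of_pow_lt_pow_left₀ (n + 1) (by positivity) ?_
  rw [one_div, Real.rpow_inv_natCast_pow (by positivity) (by simp)]
  calc R ^ n ≤ (I + J) ^ n := pow_le_pow_left₀ hR0.le hRle.le n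
    _ < (I + J) ^ (n + 1) := pow_lt_pow_right₀ h (by simp)

/-! ### Tensor products over the sources -/

/-- The tensor product of a family of operators. -/
def tensorProd {n : ℕ} {d : Type*} (M : Fin n → Matrix d d ℂ) :
    Matrix (Fin n → d) (Fin n → d) ℂ :=
  Matrix.of fun f g => ∏ i, M i (f i) (g i)

section tensorProd

variable {n : ℕ} {d : Type*}

theorem tensorProd_mul [Fintype d] (M N : Fin n → Matrix d d ℂ) :
    tensorProd M * tensorProd N = tensorProd fun i => M i * N i := by
  ext f g
  simp only [tensorProd, mul_apply, of_apply, Finset.prod_univ_sum, Fintype.piFinset_univ,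
    Finset.prod_mul_distrib]

theorem trace_tensorProd [Fintype d] (M : Fin n → Matrix d d ℂ) :
    (tensorProd M).trace = ∏ i, (M i).trace := by
  simp only [tensorProd, trace, diag_apply, of_apply, Finset.prod_univ_sum, Fintype.piFinset_univ]

theorem tensorProd_one [DecidableEq d] : tensorProd (fun _ : Fin n => (1 : Matrix d d ℂ)) = 1 := by
  ext f g
  simp only [tensorProd, of_apply, one_apply]
  by_cases h : f = g
  · simp [h]
  · obtain ⟨i, hi⟩ := Function.ne_iff.mp h
    rw [if_neg h]
    exact Finset.prod_eq_zero (Finset.mem_univ i) (if_neg hi)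

theorem tensorProd_conjTranspose (M : Fin n → Matrix d d ℂ) :
    (tensorProd M)ᴴ = tensorProd fun i => (M i)ᴴ := by
  ext f g
  simp [tensorProd, conjTranspose_apply]

end tensorProd

theorem trace_networkState_mul_jointEffect {n : ℕ} (ρ : Fin n → TwoQubitOp) (M N : Fin n → QubitOp) :
    (networkState ρ * jointEffect M (tensorProd N)).trace =
      ∏ i, (ρ i * (M i ⊗ₖ N i)).trace := by
  have h1 : networkState ρ = tensorProd ρ := rfl
  have h2 : jointEffect M (tensorProd N) = tensorProd fun i => M i ⊗ₖ N i := by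
    ext f g
    simp [jointEffect, tensorProd, kroneckerMap_apply, Finset.prod_mul_distrib]
  rw [h1, h2, tensorProd_mul, trace_tensorProd]

/-! ### Projective measurements of involutions -/

/-- The measurement with effects `(1 ± D) / 2`. -/
def involutionEffect {d : Type*} [DecidableEq d] (D : Matrix d d ℂ) (a : Fin 2) : Matrix d d ℂ :=
  (1 / 2 : ℂ) • (1 + (-1 : ℂ) ^ (a : ℕ) • D)

theorem isPOVM_involutionEffect {d : Type*} [Fintype d] [DecidableEq d] {D : Matrix d d ℂ}
    (hD : Dᴴ = D) (hD1 : D * D = 1) : IsPOVM (involutionEffect D) := by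
  refine ⟨fun a => ?_, ?_⟩
  · have hH : (involutionEffect D a)ᴴ = involutionEffect D a := by
      simp [involutionEffect, hD, conjTranspose_smul]
    have hP : (involutionEffect D a)ᴴ * involutionEffect D a = involutionEffect D a := by
      rw [hH]
      rcases neg_one_pow_eq_or ℂ (a : ℕ) with hs | hs <;>
      · simp only [involutionEffect, hs, smul_mul_assoc, mul_smul_comm, add_mul, mul_add, one_mul,
          mul_one, hD1]
        module
    rw [← hP]
    exact posSemidef_conjTranspose_mul_self _
  · rw [Fin.sum_univ_two]
    simp only [involutionEffect, Fin.val_zero, Fin.val_one, pow_zero, pow_one]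
    module

theorem involutionEffect_zero_sub_one {d : Type*} [DecidableEq d] (D : Matrix d d ℂ) :
    involutionEffect D 0 - involutionEffect D 1 = D := by
  simp only [involutionEffect, Fin.val_zero, Fin.val_one, pow_zero, pow_one]
  module

section network

variable {n : ℕ} (ρ : Fin n → TwoQubitOp) (α β : Fin n → Fin 2 → QubitOp)

/-- The correlations of the network when the outer parties measure the involutions `α i x` and the
central party measures the product of the involutions `β i y`. -/
def involutionBehaviour : Behaviour n :=
  behaviour ρ (fun i x => involutionEffect (α i x))
    (fun y => involutionEffect (tensorProd fun i => β i y))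

/-- The effect of the central party is not a product, but it is a sum of two product operators
because the joint identity is one. -/
theorem jointEffect_involutionEffect (M : Fin n → QubitOp) (N : Fin n → QubitOp) (b : Fin 2) :
    jointEffect M (involutionEffect (tensorProd N) b) =
      (1 / 2 : ℂ) • (jointEffect M (tensorProd fun _ => 1) +
        (-1 : ℂ) ^ (b : ℕ) • jointEffect M (tensorProd N)) := by
  rw [involutionEffect, ← tensorProd_one]
  ext f g
  simp only [jointEffect, of_apply, Matrix.smul_apply, Matrix.add_apply, smul_eq_mul]
  ring

/-- The identity part of the central effect does not depend on `b`, so its signed sum vanishes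
(`h'`). The involution part carries the sign `(-1)^b`, and its two halves add up to the product
(`h`). -/
theorem correlator_involutionBehaviour (x : Fin n → Fin 2) (y : Fin 2) :
    correlator (involutionBehaviour ρ α β) x y =
      (∏ i, (ρ i * (α i (x i) ⊗ₖ β i y)).trace).re := by
  have h := sum_outcomes_mul_prod
    (fun i a => (ρ i * (involutionEffect (α i (x i)) a ⊗ₖ β i y)).trace)
    (fun b : Fin 2 => (-1 : ℂ) ^ (b : ℕ) / 2)
  have h' := sum_outcomes_mul_prod
    (fun i a => (ρ i * (involutionEffect (α i (x i)) a ⊗ₖ (1 : QubitOp))).trace)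
    (fun _ : Fin 2 => (1 / 2 : ℂ))
  have hsub : ∀ i (Y : QubitOp), (ρ i * (involutionEffect (α i (x i)) 0 ⊗ₖ Y)).trace -
      (ρ i * (involutionEffect (α i (x i)) 1 ⊗ₖ Y)).trace = (ρ i * (α i (x i) ⊗ₖ Y)).trace := by
    intro i Y
    rw [← trace_sub, ← mul_sub]
    conv_rhs => rw [← involutionEffect_zero_sub_one (α i (x i))]
    congr 2
    ext a b
    simp [kroneckerMap_apply, sub_mul]
  simp only [hsub] at h h'
  have e : (∏ i, (ρ i * (α i (x i) ⊗ₖ β i y)).trace) =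
      ∑ a : Fin n → Fin 2, ∑ b : Fin 2, (-1 : ℂ) ^ ((b : ℕ) + ∑ i, (a i : ℕ)) *
        (networkState ρ * jointEffect (fun i => involutionEffect (α i (x i)) (a i))
          (involutionEffect (tensorProd fun i => β i y) b)).trace := by
    simp only [jointEffect_involutionEffect, mul_smul_comm, mul_add, trace_smul, trace_add,
      trace_networkState_mul_jointEffect, smul_eq_mul]
    norm_num at h h'
    have h2 := congrArg₂ (· + ·) h h'
    simp only [← Finset.sum_add_distrib, add_zero] at h2
    norm_num
    rw [← h2]
    refine Finset.sum_congr rfl fun a _ => ?_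
    ring
  rw [e, Complex.re_sum]
  refine Finset.sum_congr rfl fun a _ => ?_
  rw [Complex.re_sum]
  refine Finset.sum_congr rfl fun b _ => ?_
  have : ((-1 : ℂ) ^ ((b : ℕ) + ∑ i, (a i : ℕ))) =
      (((-1 : ℝ) ^ ((b : ℕ) + ∑ i, (a i : ℕ)) : ℝ) : ℂ) := by push_cast; rfl
  rw [this, Complex.re_ofReal_mul]
  rfl

theorem signedCorr_involutionBehaviour (s : ℝ) (y : Fin 2) :
    signedCorr s y (involutionBehaviour ρ α β) =
      (∏ i, (ρ i * (((1 / 2 : ℂ) • (α i 0 + (s : ℂ) • α i 1)) ⊗ₖ β i y)).trace).re := by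
  have h := sum_pow_mul_prod (s : ℂ) (fun i x => (ρ i * (α i x ⊗ₖ β i y)).trace)
  have h1 : ∀ i, (ρ i * (((1 / 2 : ℂ) • (α i 0 + (s : ℂ) • α i 1)) ⊗ₖ β i y)).trace =
      (1 / 2) * ((ρ i * (α i 0 ⊗ₖ β i y)).trace + s * (ρ i * (α i 1 ⊗ₖ β i y)).trace) := by
    intro i
    simp only [smul_kronecker, add_kronecker, mul_smul_comm, mul_add, trace_smul, trace_add,
      smul_eq_mul]
  simp only [h1, Finset.prod_mul_distrib, ← h, Finset.prod_const, Finset.card_univ,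
    Fintype.card_fin, signedCorr, correlator_involutionBehaviour]
  have h2 : ((1 / 2 : ℂ) ^ n) = ((1 / 2 ^ n : ℝ) : ℂ) := by push_cast; simp
  rw [h2, Complex.re_ofReal_mul, Complex.re_sum]
  congr 1
  refine Finset.sum_congr rfl fun x _ => ?_
  rw [← Complex.ofReal_pow, Complex.re_ofReal_mul]

theorem isNetworkNonlocal_of_involutions (hn : 1 ≤ n)
    (hα : ∀ i x, (α i x)ᴴ = α i x ∧ α i x * α i x = 1)
    (hβ : ∀ i y, (β i y)ᴴ = β i y ∧ β i y * β i y = 1) (r q : Fin n → ℝ)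
    (hr : ∀ i, (ρ i * (((1 / 2 : ℂ) • (α i 0 + α i 1)) ⊗ₖ β i 0)).trace = r i)
    (hq : ∀ i, (ρ i * (((1 / 2 : ℂ) • (α i 0 - α i 1)) ⊗ₖ β i 1)).trace = q i)
    (h : 1 < |∏ i, r i| ^ (1 / n : ℝ) + |∏ i, q i| ^ (1 / n : ℝ)) :
    IsNetworkNonlocal ρ := by
  have hI : corrI (involutionBehaviour ρ α β) = ∏ i, r i := by
    rw [corrI_eq_signedCorr, signedCorr_involutionBehaviour]
    simp only [Complex.ofReal_one, one_smul, hr, ← Complex.ofReal_prod, Complex.ofReal_re]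
  have hJ : corrJ (involutionBehaviour ρ α β) = ∏ i, q i := by
    rw [corrJ_eq_signedCorr, signedCorr_involutionBehaviour]
    simp only [Complex.ofReal_neg, Complex.ofReal_one, neg_smul, one_smul, ← sub_eq_add_neg, hq,
      ← Complex.ofReal_prod, Complex.ofReal_re]
  have hS : 1 < nStar (involutionBehaviour ρ α β) := by rwa [nStar, hI, hJ]
  refine ⟨_, _, fun i x => isPOVM_involutionEffect (hα i x).1 (hα i x).2,
    fun y => isPOVM_involutionEffect ?_ ?_, hS, fun hL => (hL.nStar_le_one hn).not_gt hS⟩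
  · simp only [tensorProd_conjTranspose, (hβ _ y).1]
  · simp only [tensorProd_mul, (hβ _ y).2, tensorProd_one]

end network

/-! ### Pauli matrices -/

theorem pauli_conjTranspose (i : Fin 3) : (pauli i)ᴴ = pauli i := by
  fin_cases i <;> ext a b <;> fin_cases a <;> fin_cases b <;> simp [pauli, conjTranspose_apply]

theorem sigma_conjTranspose (r : Fin 3 → ℝ) : (sigma r)ᴴ = sigma r := by
  simp [sigma, conjTranspose_sum, conjTranspose_smul, pauli_conjTranspose]

theorem sigma_eq (r : Fin 3 → ℝ) :
    sigma r = !![(r 2 : ℂ), r 0 - Complex.I * r 1; r 0 + Complex.I * r 1, -(r 2 : ℂ)] := by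
  ext a b
  fin_cases a <;> fin_cases b <;> simp [sigma, pauli, Fin.sum_univ_three] <;> ring

theorem sigma_mul_add_mul (u v : Fin 3 → ℝ) :
    sigma u * sigma v + sigma v * sigma u = ((2 * (u ⬝ᵥ v) : ℝ) : ℂ) • (1 : QubitOp) := by
  rw [sigma_eq, sigma_eq]
  ext a b
  fin_cases a <;> fin_cases b <;>
    simp [dotProduct, Fin.sum_univ_three] <;>
    ring_nf <;> simp only [Complex.I_sq] <;> ring

theorem sigma_mul_self {u : Fin 3 → ℝ} (hu : u ⬝ᵥ u = 1) : sigma u * sigma u = 1 := by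
  have h := sigma_mul_add_mul u u
  rw [hu] at h
  have h2 : (2 : ℂ) • (sigma u * sigma u) = (2 : ℂ) • (1 : QubitOp) := by
    rw [two_smul, h]; norm_num
  exact smul_right_injective _ (two_ne_zero) h2

theorem sigma_mul_comm_neg {u v : Fin 3 → ℝ} (h : u ⬝ᵥ v = 0) :
    sigma v * sigma u = -(sigma u * sigma v) := by
  have := sigma_mul_add_mul u v
  rw [h] at this
  simp only [mul_zero, Complex.ofReal_zero, zero_smul] at this
  exact (neg_eq_of_add_eq_zero_right this).symm

/-- `corrMatrix` keeps only the real part of the trace; nothing is lost, since the trace of a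
product of two Hermitian operators is real. -/
theorem trace_mul_pauli_kronecker {ρ : TwoQubitOp} (hρ : ρᴴ = ρ) (i j : Fin 3) :
    (ρ * (pauli i ⊗ₖ pauli j)).trace = (corrMatrix ρ i j : ℂ) := by
  have h : star (ρ * (pauli i ⊗ₖ pauli j)).trace = (ρ * (pauli i ⊗ₖ pauli j)).trace := by
    rw [← trace_conjTranspose, conjTranspose_mul, conjTranspose_kronecker, hρ, pauli_conjTranspose,
      pauli_conjTranspose, trace_mul_comm]
  exact (Complex.conj_eq_iff_re.mp h).symm

theorem trace_mul_sigma_kronecker {ρ : TwoQubitOp} (hρ : ρᴴ = ρ) (u w : Fin 3 → ℝ) :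
    (ρ * (sigma u ⊗ₖ sigma w)).trace = ((u ⬝ᵥ (corrMatrix ρ *ᵥ w) : ℝ) : ℂ) := by
  simp only [sigma, Fin.sum_univ_three, add_kronecker, kronecker_add, smul_kronecker,
    kronecker_smul, mul_add, mul_smul_comm, trace_add, trace_smul, trace_mul_pauli_kronecker hρ,
    dotProduct, mulVec, smul_eq_mul]
  push_cast
  ring

/-! ### Square roots of effects -/

/-- If `N² = η²`, then `p + qN` can only have the eigenvalues `p ± qη`. Its root `x + yN` should
have the eigenvalues `√(p ± qη)`, and solving for `x` and `y` gives the witnesses. -/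
theorem exists_sqrt_coeffs {p q η : ℝ} (hη : 0 < η) (hq : 0 ≤ q) (h : q * η ≤ p) :
    ∃ x y : ℝ, 0 ≤ x ∧ 0 ≤ y ∧ x ^ 2 + y ^ 2 * η ^ 2 = p ∧ 2 * x * y = q ∧ y * η ≤ x := by
  have hqη : 0 ≤ q * η := by positivity
  have hA : √(p + q * η) ^ 2 = p + q * η := Real.sq_sqrt (by linarith)
  have hB : √(p - q * η) ^ 2 = p - q * η := Real.sq_sqrt (by linarith)
  have hle : √(p - q * η) ≤ √(p + q * η) := Real.sqrt_le_sqrt (by linarith)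
  have hB0 := Real.sqrt_nonneg (p - q * η)
  set A := √(p + q * η)
  set B := √(p - q * η)
  have hy : (A - B) / (2 * η) * η = (A - B) / 2 := by field_simp
  refine ⟨(A + B) / 2, (A - B) / (2 * η), by linarith,
    div_nonneg (by linarith) (by linarith), ?_, ?_, ?_⟩
  · rw [← mul_pow, hy]; nlinarith
  · refine mul_right_cancel₀ hη.ne' ?_
    rw [mul_assoc, hy]; nlinarith
  · rw [hy]; linarith

section sqrt

variable {N : QubitOp} {η : ℝ}

theorem affine_mul_self (hN1 : N * N = ((η ^ 2 : ℝ) : ℂ) • (1 : QubitOp)) (x y : ℝ) :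
    ((x : ℂ) • (1 : QubitOp) + (y : ℂ) • N) * ((x : ℂ) • (1 : QubitOp) + (y : ℂ) • N) =
      ((x ^ 2 + y ^ 2 * η ^ 2 : ℝ) : ℂ) • (1 : QubitOp) + ((2 * x * y : ℝ) : ℂ) • N := by
  simp only [add_mul, mul_add, smul_mul_assoc, mul_smul_comm, one_mul, mul_one, hN1]
  push_cast
  module

theorem posSemidef_affine (hN : Nᴴ = N) (hN1 : N * N = ((η ^ 2 : ℝ) : ℂ) • (1 : QubitOp))
    (hη : 0 < η) {p q : ℝ} (hq : 0 ≤ q) (h : q * η ≤ p) :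
    ((p : ℂ) • (1 : QubitOp) + (q : ℂ) • N).PosSemidef := by
  obtain ⟨x, y, -, -, h1, h2, -⟩ := exists_sqrt_coeffs hη hq h
  have h3 := affine_mul_self hN1 x y
  rw [h1, h2] at h3
  have h4 : ((x : ℂ) • (1 : QubitOp) + (y : ℂ) • N)ᴴ = (x : ℂ) • (1 : QubitOp) + (y : ℂ) • N := by
    simp [hN, conjTranspose_smul]
  rw [← h3]
  nth_rewrite 1 [← h4]
  exact posSemidef_conjTranspose_mul_self _

end sqrt

/-- The coefficients depend on `η` alone, so one pair `x`, `y` serves every input and outcome. The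
bound on `y` comes from `xy = 1/4` and `x² ≥ 1/4`. -/
theorem exists_sqrt_effect {η : ℝ} (hη : 0 < η) (hη1 : η ≤ 1) :
    ∃ x y : ℝ, x ^ 2 + y ^ 2 * η ^ 2 = 1 / 2 ∧ 4 * y ^ 2 ≤ 1 ∧
      ∀ N : QubitOp, Nᴴ = N → N * N = ((η ^ 2 : ℝ) : ℂ) • (1 : QubitOp) →
        CFC.sqrt ((1 / 2 : ℂ) • (1 + N)) = (x : ℂ) • (1 : QubitOp) + (y : ℂ) • N := by
  obtain ⟨x, y, hx, hy, h1, h2, h3⟩ := exists_sqrt_coeffs (p := 1 / 2) (q := 1 / 2) hη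
    (by norm_num) (by linarith)
  refine ⟨x, y, h1, ?_, fun N hN hN1 => CFC.sqrt_unique ?_ ?_⟩
  · have hx2 : 1 / 4 ≤ x ^ 2 := by nlinarith [mul_nonneg hy hη.le]
    have hxy : x ^ 2 * (16 * y ^ 2) = 1 := by
      have : x * y = 1 / 4 := by linarith
      calc x ^ 2 * (16 * y ^ 2) = 16 * (x * y) ^ 2 := by ring
        _ = 1 := by rw [this]; norm_num
    nlinarith [sq_nonneg y]
  · rw [affine_mul_self hN1, h1, h2, smul_add]
    norm_num
  · exact (posSemidef_affine hN hN1 hη hy h3).nonneg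

/-! ### The sequential measurements in the Heisenberg picture -/

/-- The adjoint of `measureStep`, acting on observables of the first qubit. -/
def dualStep (E : Fin 2 → Fin 2 → QubitOp) (X : QubitOp) : QubitOp :=
  (1 / 2 : ℂ) • ∑ x, ∑ a, CFC.sqrt (E x a) * X * CFC.sqrt (E x a)

theorem trace_measureStep_mul (E : Fin 2 → Fin 2 → QubitOp) (ρ : TwoQubitOp) (X Y : QubitOp) :
    (measureStep E ρ * (X ⊗ₖ Y)).trace = (ρ * (dualStep E X ⊗ₖ Y)).trace := by
  have h : ∀ S : QubitOp, ((S ⊗ₖ (1 : QubitOp)) * ρ * (S ⊗ₖ (1 : QubitOp)) * (X ⊗ₖ Y)).trace =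
      (ρ * ((S * X * S) ⊗ₖ Y)).trace := by
    intro S
    rw [mul_assoc, mul_assoc, trace_mul_comm, mul_assoc, mul_assoc, mul_assoc,
      ← mul_kronecker_mul, ← mul_kronecker_mul, mul_one, one_mul]
  simp only [measureStep, dualStep, Fin.sum_univ_two, smul_mul_assoc, add_mul, smul_kronecker,
    add_kronecker, mul_smul_comm, mul_add, trace_smul, trace_add, h]

/-- An observable that is a common eigenvector of all dual steps merely collects one factor per
measurement; the intermediate states need not be computed. -/
theorem trace_stateAfter_mul {E : ℕ → Fin 2 → Fin 2 → QubitOp} {X : QubitOp} {κ : ℝ}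
    (h : ∀ k, dualStep (E k) X = (κ : ℂ) • X) (ρ : TwoQubitOp) (Y : QubitOp) (j : ℕ) :
    (stateAfter E ρ j * (X ⊗ₖ Y)).trace = (κ ^ j : ℝ) * (ρ * (X ⊗ₖ Y)).trace := by
  induction j with
  | zero => simp [stateAfter]
  | succ j ih =>
    rw [stateAfter, trace_measureStep_mul, h, smul_kronecker, mul_smul_comm, trace_smul, ih,
      smul_eq_mul]
    push_cast
    ring

/-- Summing over the signs removes the cross terms. Of the rest, `U * U * U = U` and `V * U * V =
-U`, whence the sign of `g ^ 2`. -/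
theorem sum_sandwich_left {U V : QubitOp} (hU : U * U = 1) (hV : V * V = 1)
    (hVU : V * U = -(U * V)) (x y c g : ℂ) :
    (1 / 2 : ℂ) • ∑ i : Fin 2, ∑ a : Fin 2,
      (x • (1 : QubitOp) + y • ((-1 : ℂ) ^ (a : ℕ) • (c • U + ((-1 : ℂ) ^ (i : ℕ) * g) • V))) * U *
        (x • (1 : QubitOp) + y • ((-1 : ℂ) ^ (a : ℕ) • (c • U + ((-1 : ℂ) ^ (i : ℕ) * g) • V))) =
      (2 * (x ^ 2 + y ^ 2 * (c ^ 2 - g ^ 2))) • U := by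
  have h1 : ∀ X : QubitOp, U * (U * X) = X := fun X => by rw [← mul_assoc, hU, one_mul]
  have h2 : ∀ X : QubitOp, V * (V * X) = X := fun X => by rw [← mul_assoc, hV, one_mul]
  have h3 : ∀ X : QubitOp, V * (U * X) = -(U * (V * X)) := fun X => by
    rw [← mul_assoc, hVU, neg_mul, mul_assoc]
  simp only [Fin.sum_univ_two, Fin.val_zero, Fin.val_one, pow_zero, pow_one, add_mul, mul_add,
    smul_mul_assoc, mul_smul_comm, one_mul, mul_one, mul_assoc, hU, hV, hVU, h1, smul_add,
    mul_neg, neg_mul, smul_neg]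
  module

theorem sum_sandwich_right {U V : QubitOp} (hU : U * U = 1) (hV : V * V = 1)
    (hVU : V * U = -(U * V)) (x y c g : ℂ) :
    (1 / 2 : ℂ) • ∑ i : Fin 2, ∑ a : Fin 2,
      (x • (1 : QubitOp) + y • ((-1 : ℂ) ^ (a : ℕ) • (c • U + ((-1 : ℂ) ^ (i : ℕ) * g) • V))) * V *
        (x • (1 : QubitOp) + y • ((-1 : ℂ) ^ (a : ℕ) • (c • U + ((-1 : ℂ) ^ (i : ℕ) * g) • V))) =
      (2 * (x ^ 2 + y ^ 2 * (g ^ 2 - c ^ 2))) • V := by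
  have h1 : ∀ X : QubitOp, U * (U * X) = X := fun X => by rw [← mul_assoc, hU, one_mul]
  have h2 : ∀ X : QubitOp, V * (V * X) = X := fun X => by rw [← mul_assoc, hV, one_mul]
  have h3 : ∀ X : QubitOp, V * (U * X) = -(U * (V * X)) := fun X => by
    rw [← mul_assoc, hVU, neg_mul, mul_assoc]
  simp only [Fin.sum_univ_two, Fin.val_zero, Fin.val_one, pow_zero, pow_one, add_mul, mul_add,
    smul_mul_assoc, mul_smul_comm, one_mul, mul_one, mul_assoc, hV, hVU, h1, smul_add,
    mul_neg, neg_mul, smul_neg]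
  module

/-- The sequential measurements scale `σ_u` and `σ_v`; a small sharpness hardly affects `σ_u`, and
leaves at least the fraction `sin² θ` of `σ_v`. -/
theorem exists_dualStep_seqPOVM {u v : Fin 3 → ℝ} (hu : u ⬝ᵥ u = 1) (hv : v ⬝ᵥ v = 1)
    (huv : u ⬝ᵥ v = 0) {θ γ : ℝ} (hc : 0 < Real.cos θ) (hγ : 0 < γ) (hγ1 : γ < 1) :
    ∃ κ μ : ℝ, dualStep (seqPOVM u v θ γ) (sigma u) = (κ : ℂ) • sigma u ∧
      dualStep (seqPOVM u v θ γ) (sigma v) = (μ : ℂ) • sigma v ∧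
      1 - γ ^ 2 ≤ κ ∧ Real.sin θ ^ 2 ≤ μ := by
  have hE0 : ∀ i a : Fin 2, seqPOVM u v θ γ i a = (1 / 2 : ℂ) • (1 + (-1 : ℂ) ^ (a : ℕ) •
    (((Real.cos θ : ℝ) : ℂ) • sigma u +
      ((-1 : ℂ) ^ (i : ℕ) * ((γ * Real.sin θ : ℝ) : ℂ)) • sigma v)) := fun _ _ => rfl
  have hcs := Real.sin_sq_add_cos_sq θ
  have hγ2 : γ ^ 2 ≤ 1 := pow_le_one₀ hγ.le hγ1.le
  have hg2 : (γ * Real.sin θ) ^ 2 ≤ Real.sin θ ^ 2 := by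
    rw [mul_pow]; exact mul_le_of_le_one_left (sq_nonneg _) hγ2
  have hg2' : (γ * Real.sin θ) ^ 2 ≤ γ ^ 2 := by
    rw [mul_pow]; exact mul_le_of_le_one_right (sq_nonneg _) (Real.sin_sq_le_one θ)
  generalize γ * Real.sin θ = g at *
  generalize Real.cos θ = c at *
  have hη0 : 0 < √(c ^ 2 + g ^ 2) := Real.sqrt_pos.mpr (by positivity)
  have hη2 : √(c ^ 2 + g ^ 2) ^ 2 = c ^ 2 + g ^ 2 := Real.sq_sqrt (by positivity)
  have hη1 : √(c ^ 2 + g ^ 2) ≤ 1 := by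
    rw [Real.sqrt_le_one]; linarith
  obtain ⟨x, y, hxy, hy, hsqrt⟩ := exists_sqrt_effect hη0 hη1
  rw [hη2] at hxy hsqrt
  have hU := sigma_mul_self hu
  have hV := sigma_mul_self hv
  have hVU := sigma_mul_comm_neg huv
  have hE : ∀ i a : Fin 2, CFC.sqrt (seqPOVM u v θ γ i a) = (x : ℂ) • (1 : QubitOp) +
      (y : ℂ) • ((-1 : ℂ) ^ (a : ℕ) • ((c : ℂ) • sigma u +
        ((-1 : ℂ) ^ (i : ℕ) * (g : ℂ)) • sigma v)) := by
    intro i a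
    rw [hE0]
    refine hsqrt _ ?_ ?_
    · simp [conjTranspose_smul, sigma_conjTranspose]
    · rcases neg_one_pow_eq_or ℂ (a : ℕ) with ha | ha <;>
      rcases neg_one_pow_eq_or ℂ (i : ℕ) with hi | hi <;>
      · rw [ha, hi]
        simp only [add_mul, mul_add, smul_mul_assoc, mul_smul_comm, hU, hV, hVU]
        push_cast
        module
  refine ⟨2 * (x ^ 2 + y ^ 2 * (c ^ 2 - g ^ 2)), 2 * (x ^ 2 + y ^ 2 * (g ^ 2 - c ^ 2)),
    ?_, ?_, ?_, ?_⟩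
  · simp only [dualStep, hE]
    rw [sum_sandwich_left hU hV hVU]
    push_cast
    rfl
  · simp only [dualStep, hE]
    rw [sum_sandwich_right hU hV hVU]
    push_cast
    rfl
  -- By the normalization `hxy` the two factors equal `1 - 4y²g²` and `1 - 4y²c²`; now `4y² ≤ 1`
  -- bounds them below by `1 - g²` and `1 - c²`.
  · nlinarith [sq_nonneg g]
  · nlinarith [sq_nonneg c]

/-! ### Singular values of the correlation matrix -/

section singularValues

variable (M : Matrix (Fin 3) (Fin 3) ℝ)

theorem adjoint_comp_toEuclideanLin :
    (toEuclideanLin M).adjoint ∘ₗ toEuclideanLin M = toEuclideanLin (Mᵀ * M) := by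
  rw [← conjTranspose_eq_transpose_of_trivial, ← Matrix.toEuclideanLin_conjTranspose_eq_adjoint]
  ext x
  simp [toLpLin_apply]

theorem exists_right_singular_vectors :
    ∃ w : Fin 3 → Fin 3 → ℝ, (∀ i j, w i ⬝ᵥ w j = if i = j then 1 else 0) ∧
      ∀ i, (Mᵀ * M) *ᵥ w i = ((toEuclideanLin M).singularValues i ^ 2) • w i := by
  have hn : Module.finrank ℝ (EuclideanSpace ℝ (Fin 3)) = 3 := by simp
  set hT := (toEuclideanLin M).isSymmetric_adjoint_comp_self
  refine ⟨fun i => (hT.eigenvectorBasis hn i).ofLp, fun i j => ?_, fun i => ?_⟩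
  · have := (orthonormal_iff_ite.mp (hT.eigenvectorBasis hn).orthonormal) j i
    rw [EuclideanSpace.inner_eq_star_dotProduct] at this
    simpa [eq_comm] using this
  · have := hT.apply_eigenvectorBasis hn i
    rw [LinearMap.congr_fun (adjoint_comp_toEuclideanLin M)] at this
    rw [(toEuclideanLin M).sq_singularValues_fin hn i]
    have h := congrArg WithLp.ofLp this
    rw [ofLp_toLpLin, toLin'_apply] at h
    simpa using h

theorem one_le_singularValues_zero {w : Fin 3 → ℝ} (hw : w ≠ 0) (h : (Mᵀ * M) *ᵥ w = w) :
    1 ≤ (toEuclideanLin M).singularValues 0 := by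
  have hn : Module.finrank ℝ (EuclideanSpace ℝ (Fin 3)) = 3 := by simp
  set hT := (toEuclideanLin M).isSymmetric_adjoint_comp_self
  have hev : Module.End.HasEigenvalue ((toEuclideanLin M).adjoint ∘ₗ toEuclideanLin M) 1 := by
    refine Module.End.hasEigenvalue_of_hasEigenvector (x := WithLp.toLp 2 w)
      ⟨Module.End.mem_eigenspace_iff.mpr ?_, by simpa using hw⟩
    rw [adjoint_comp_toEuclideanLin, toLpLin_toLp, toLin'_apply, h, one_smul]
  obtain ⟨i, hi⟩ := hT.exists_eigenvalues_eq hn hev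
  have h1 : (1 : ℝ) ≤ (toEuclideanLin M).singularValues 0 ^ 2 := by
    have h0 := (toEuclideanLin M).sq_singularValues_fin hn 0
    rw [Fin.val_zero] at h0
    rw [h0]
    calc (1 : ℝ) = hT.eigenvalues hn i := by simpa using hi.symm
      _ ≤ _ := hT.eigenvalues_antitone hn (Fin.zero_le i)
  exact (one_le_sq_iff₀ ((toEuclideanLin M).singularValues_nonneg 0)).mp h1

theorem singularValues_pos_of_isUnit (h : IsUnit M.det) {i : ℕ} (hi : i < 3) :
    0 < (toEuclideanLin M).singularValues i := by
  refine (toEuclideanLin M).injective_iff_forall_lt_finrank_singularValues_pos.mp ?_ i (by simpa)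
  intro x y hxy
  have := congrArg WithLp.ofLp hxy
  rw [ofLp_toLpLin, ofLp_toLpLin, toLin'_apply, toLin'_apply] at this
  exact WithLp.ofLp_injective 2
    (mulVec_injective_of_isUnit ((isUnit_iff_isUnit_det M).mpr h) this)

end singularValues

/-- Right singular vectors are carried to left ones by `t`; positive singular values allow the
images to be normalized. -/
theorem exists_isCorrFrame {ρ : TwoQubitOp} (h0 : 0 < delta ρ 0) (h1 : 0 < delta ρ 1) :
    ∃ u v : Fin 3 → ℝ, IsCorrFrame ρ u v := by
  obtain ⟨w, hw, hM⟩ := exists_right_singular_vectors (corrMatrix ρ)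
  have hM0 : ((corrMatrix ρ)ᵀ * corrMatrix ρ) *ᵥ w 0 = (delta ρ 0 ^ 2) • w 0 := hM 0
  have hM1 : ((corrMatrix ρ)ᵀ * corrMatrix ρ) *ᵥ w 1 = (delta ρ 1 ^ 2) • w 1 := hM 1
  set M := corrMatrix ρ
  have hdot : ∀ x y : Fin 3 → ℝ, (M *ᵥ x) ⬝ᵥ (M *ᵥ y) = x ⬝ᵥ ((Mᵀ * M) *ᵥ y) := by
    intro x y
    rw [← mulVec_mulVec, dotProduct_mulVec x, vecMul_transpose]
  have heig : ∀ (x : Fin 3 → ℝ) (d : ℝ), (Mᵀ * M) *ᵥ x = (d ^ 2) • x →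
      (M * Mᵀ) *ᵥ (d⁻¹ • M *ᵥ x) = (d ^ 2) • (d⁻¹ • M *ᵥ x) := by
    intro x d hx
    rw [mulVec_smul, mulVec_mulVec, mul_assoc, ← mulVec_mulVec, hx, mulVec_smul, smul_comm]
  refine ⟨(delta ρ 0)⁻¹ • M *ᵥ w 0, (delta ρ 1)⁻¹ • M *ᵥ w 1, ?_, ?_, ?_, heig _ _ hM0,
    heig _ _ hM1⟩
  · rw [smul_dotProduct, dotProduct_smul, hdot, hM0, dotProduct_smul, hw]
    simp only [if_true, smul_eq_mul]
    field_simp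
  · rw [smul_dotProduct, dotProduct_smul, hdot, hM1, dotProduct_smul, hw]
    simp only [if_true, smul_eq_mul]
    field_simp
  · rw [smul_dotProduct, dotProduct_smul, hdot, hM1, dotProduct_smul, hw]
    simp

/-! ### Pure states -/

/-- The Bloch vector of the first qubit of the pure state `φ`. -/
def blochVec (φ : Fin 2 × Fin 2 → ℂ) : Fin 3 → ℝ :=
  fun i => ((vecMulVec φ (star φ) * (pauli i ⊗ₖ (1 : QubitOp))).trace).re

/-- The square of the concurrence of the pure state `φ`. -/
def sqConcurrence (φ : Fin 2 × Fin 2 → ℂ) : ℝ :=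
  4 * Complex.normSq (φ (0, 0) * φ (1, 1) - φ (0, 1) * φ (1, 0))

theorem corrMatrix_pure_mul_transpose (φ : Fin 2 × Fin 2 → ℂ) :
    corrMatrix (vecMulVec φ (star φ)) * (corrMatrix (vecMulVec φ (star φ)))ᵀ =
      sqConcurrence φ • (1 : Matrix (Fin 3) (Fin 3) ℝ) + vecMulVec (blochVec φ) (blochVec φ) := by
  ext i j
  fin_cases i <;> fin_cases j <;>
    simp [mul_apply, corrMatrix, trace, vecMulVec_apply, Fintype.sum_prod_type, Fin.sum_univ_three,
      pauli, kroneckerMap_apply, sqConcurrence, blochVec, Complex.normSq_apply, one_apply] <;>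
    ring

theorem blochVec_dotProduct_self (φ : Fin 2 × Fin 2 → ℂ) (h : star φ ⬝ᵥ φ = 1) :
    blochVec φ ⬝ᵥ blochVec φ + sqConcurrence φ = 1 := by
  -- Replacing `1` by the squared norm to the second power makes the claim a homogeneous polynomial
  -- identity of degree four.
  have h1 : (star φ ⬝ᵥ φ).re ^ 2 = 1 := by rw [h]; simp
  rw [← h1]
  simp [mul_apply, trace, vecMulVec_apply, Fintype.sum_prod_type, Fin.sum_univ_three, dotProduct,
    pauli, kroneckerMap_apply, sqConcurrence, blochVec, Complex.normSq_apply, one_apply]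
  ring

theorem isState_of_unit {d : Type*} [Fintype d] {φ : d → ℂ} (h : star φ ⬝ᵥ φ = 1) :
    IsState (vecMulVec φ (star φ)) :=
  ⟨posSemidef_vecMulVec_self_star φ, by rw [trace_vecMulVec, dotProduct_comm, h]⟩

theorem isSeparable_of_product {x y : Fin 2 → ℂ} (hx : star x ⬝ᵥ x = 1) (hy : star y ⬝ᵥ y = 1)
    {φ : Fin 2 × Fin 2 → ℂ} (h : ∀ i j, φ (i, j) = x i * y j) :
    IsSeparable (vecMulVec φ (star φ)) := by
  refine ⟨1, fun _ => 1, fun _ => vecMulVec x (star x), fun _ => vecMulVec y (star y), by simp,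
    by simp, fun _ => isState_of_unit hx, fun _ => isState_of_unit hy, ?_⟩
  ext ⟨i, j⟩ ⟨k, l⟩
  simp [vecMulVec_apply, kroneckerMap_apply, h]
  ring

/-- A vanishing determinant means that the coefficient matrix has rank one. It is then the product
of a column and a row through a nonzero entry, with scalars moved between them to make both unit
vectors. -/
theorem isSeparable_of_det_eq_zero {φ : Fin 2 × Fin 2 → ℂ} (hφ : star φ ⬝ᵥ φ = 1)
    (h : φ (0, 0) * φ (1, 1) = φ (0, 1) * φ (1, 0)) : IsSeparable (vecMulVec φ (star φ)) := by
  have hne : ∃ i j, φ (i, j) ≠ 0 := by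
    by_contra! h0
    have : φ = 0 := funext fun ⟨i, j⟩ => h0 i j
    simp [this] at hφ
  obtain ⟨i₀, j₀, h0⟩ := hne
  have hdet : ∀ i j, φ (i, j) * φ (i₀, j₀) = φ (i, j₀) * φ (i₀, j) := by
    intro i j
    fin_cases i <;> fin_cases j <;> fin_cases i₀ <;> fin_cases j₀ <;>
      simp only [Fin.zero_eta, Fin.mk_one] <;> first | ring1 | linear_combination h |
        linear_combination -h
  set s : ℝ := Complex.normSq (φ (0, j₀)) + Complex.normSq (φ (1, j₀)) with hs
  have hs0 : 0 < s := by
    have h2 := Complex.normSq_pos.mpr h0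
    have h3 := Complex.normSq_nonneg (φ (0, j₀))
    have h4 := Complex.normSq_nonneg (φ (1, j₀))
    fin_cases i₀ <;> simp only [Fin.zero_eta, Fin.mk_one] at h2 <;> rw [hs] <;> linarith
  have hr : ((√s : ℝ) : ℂ) ≠ 0 := by exact_mod_cast (Real.sqrt_pos.mpr hs0).ne'
  have hr2 : ((√s : ℝ) : ℂ) * (√s : ℝ) = s := by
    exact_mod_cast Real.mul_self_sqrt hs0.le
  set x : Fin 2 → ℂ := fun i => φ (i, j₀) / (√s : ℝ) with hx
  set y : Fin 2 → ℂ := fun j => φ (i₀, j) * (√s : ℝ) / φ (i₀, j₀) with hy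
  have hxy : ∀ i j, φ (i, j) = x i * y j := by
    intro i j
    have : x i * y j = φ (i, j₀) * φ (i₀, j) / φ (i₀, j₀) := by
      simp only [hx, hy]; field_simp
    rw [this, eq_div_iff h0, hdet]
  have hx1 : star x ⬝ᵥ x = 1 := by
    simp only [hx, dotProduct, Fin.sum_univ_two, Pi.star_apply, star_div₀, Complex.star_def,
      Complex.conj_ofReal, div_mul_div_comm, hr2, ← Complex.normSq_eq_conj_mul_self, ← add_div]
    rw [← Complex.ofReal_add, ← hs, div_self (by exact_mod_cast hs0.ne')]
  refine isSeparable_of_product hx1 ?_ hxy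
  have hprod : star φ ⬝ᵥ φ = (star x ⬝ᵥ x) * (star y ⬝ᵥ y) := by
    simp only [dotProduct, Fintype.sum_prod_type, Fin.sum_univ_two, Pi.star_apply, hxy, star_mul']
    ring
  rwa [hφ, hx1, one_mul, eq_comm] at hprod

theorem delta_of_pure_entangled {ρ : TwoQubitOp} (hp : IsPure ρ) (he : IsEntangled ρ) :
    1 ≤ delta ρ 0 ∧ 0 < delta ρ 1 := by
  obtain ⟨φ, hφ, rfl⟩ := hp
  have hC : 0 < sqConcurrence φ := by
    refine mul_pos (by norm_num) (Complex.normSq_pos.mpr fun h => he ?_)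
    exact isSeparable_of_det_eq_zero hφ (sub_eq_zero.mp h)
  have hMM := corrMatrix_pure_mul_transpose φ
  have ha := blochVec_dotProduct_self φ hφ
  unfold delta
  set M := corrMatrix (vecMulVec φ (star φ))
  set a := blochVec φ
  set C := sqConcurrence φ
  have hmul : ∀ x, (M * Mᵀ) *ᵥ x = C • x + (a ⬝ᵥ x) • a := by
    intro x
    rw [hMM, add_mulVec, smul_mulVec, one_mulVec, vecMulVec_mulVec]
    simp
  have hinj : ∀ x, Mᵀ *ᵥ x = 0 → x = 0 := by
    intro x hx
    have h1 := hmul x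
    rw [← mulVec_mulVec, hx, mulVec_zero] at h1
    have h2 := congrArg (fun z => x ⬝ᵥ z) h1
    simp only [dotProduct_zero, dotProduct_add, dotProduct_smul, smul_eq_mul] at h2
    rw [dotProduct_comm x a] at h2
    have h3 : 0 ≤ x ⬝ᵥ x := Finset.sum_nonneg fun i _ => mul_self_nonneg _
    have h4 : x ⬝ᵥ x = 0 := by nlinarith [mul_self_nonneg (a ⬝ᵥ x)]
    exact dotProduct_self_eq_zero.mp h4
  have hdet : IsUnit M.det := by
    rw [isUnit_iff_ne_zero, ← det_transpose]
    intro h0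
    obtain ⟨x, hx, hx0⟩ := exists_mulVec_eq_zero_iff.mpr h0
    exact hx (hinj x hx0)
  refine ⟨?_, singularValues_pos_of_isUnit M hdet (by norm_num)⟩
  -- The Bloch vector is fixed because `|a|² + C² = 1` (here `C` is the squared concurrence). If `a
  -- = 0`, the state is maximally entangled and `t tᵀ = 1`. The transpose `tᵀ` then carries the
  -- fixed vector over to `tᵀ t`.
  obtain ⟨x, hx, hfix⟩ : ∃ x, x ≠ 0 ∧ (M * Mᵀ) *ᵥ x = x := by
    by_cases h0 : a = 0
    · refine ⟨Pi.single 0 1, by simp, ?_⟩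
      rw [h0, zero_dotProduct, zero_add] at ha
      rw [hmul, h0, ha]
      simp
    · refine ⟨a, h0, ?_⟩
      rw [hmul, ← add_smul, add_comm, ha, one_smul]
  refine one_le_singularValues_zero M (w := Mᵀ *ᵥ x) (fun h => hx (hinj x h)) ?_
  rw [mulVec_mulVec, mul_assoc, ← mulVec_mulVec, hfix]

/-! ### Violation of the inequality -/

theorem trace_bellState_mul_sigma_z :
    (bellState * (sigma ![0, 0, 1] ⊗ₖ sigma ![0, 0, 1])).trace = 1 := by
  have h : ((√2 : ℝ) : ℂ)⁻¹ * ((√2 : ℝ) : ℂ)⁻¹ = 1 / 2 := by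
    rw [← mul_inv, ← Complex.ofReal_mul, Real.mul_self_sqrt (by norm_num)]; norm_num
  rw [sigma_eq]
  simp [trace, mul_apply, bellState, bellVec, vecMulVec_apply, Fintype.sum_prod_type,
    kroneckerMap_apply, h]
  norm_num

theorem trace_bellState_mul_sigma_x :
    (bellState * (sigma ![1, 0, 0] ⊗ₖ sigma ![1, 0, 0])).trace = 1 := by
  have h : ((√2 : ℝ) : ℂ)⁻¹ * ((√2 : ℝ) : ℂ)⁻¹ = 1 / 2 := by
    rw [← mul_inv, ← Complex.ofReal_mul, Real.mul_self_sqrt (by norm_num)]; norm_num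
  rw [sigma_eq]
  simp [trace, mul_apply, bellState, bellVec, vecMulVec_apply, Fintype.sum_prod_type,
    kroneckerMap_apply, h]
  norm_num

/-- The observables `c σ_u ± s σ_v`. -/
def rotatedSigma (c s : ℝ) (u v : Fin 3 → ℝ) (x : Fin 2) : QubitOp :=
  (c : ℂ) • sigma u + ((-1 : ℂ) ^ (x : ℕ) * (s : ℂ)) • sigma v

section rotatedSigma

variable (c s : ℝ) (u v : Fin 3 → ℝ)

theorem rotatedSigma_involution {c s : ℝ} {u v : Fin 3 → ℝ} (hcs : c ^ 2 + s ^ 2 = 1)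
    (hu : u ⬝ᵥ u = 1) (hv : v ⬝ᵥ v = 1) (huv : u ⬝ᵥ v = 0) (x : Fin 2) :
    (rotatedSigma c s u v x)ᴴ = rotatedSigma c s u v x ∧
      rotatedSigma c s u v x * rotatedSigma c s u v x = 1 := by
  constructor
  · simp [rotatedSigma, conjTranspose_smul, sigma_conjTranspose]
  · have h1 : (1 : QubitOp) = ((c ^ 2 + s ^ 2 : ℝ) : ℂ) • (1 : QubitOp) := by rw [hcs]; simp
    rw [h1]
    rcases neg_one_pow_eq_or ℂ (x : ℕ) with hx | hx <;>
    · simp only [rotatedSigma, hx, add_mul, mul_add, smul_mul_assoc, mul_smul_comm,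
        sigma_mul_self hu, sigma_mul_self hv, sigma_mul_comm_neg huv]
      push_cast
      module

theorem half_rotatedSigma_add :
    (1 / 2 : ℂ) • (rotatedSigma c s u v 0 + rotatedSigma c s u v 1) = (c : ℂ) • sigma u := by
  simp only [rotatedSigma, Fin.val_zero, Fin.val_one, pow_zero, pow_one]
  module

theorem half_rotatedSigma_sub :
    (1 / 2 : ℂ) • (rotatedSigma c s u v 0 - rotatedSigma c s u v 1) = (s : ℂ) • sigma v := by
  simp only [rotatedSigma, Fin.val_zero, Fin.val_one, pow_zero, pow_one]
  module

end rotatedSigma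

theorem isNetworkNonlocal_sources {τ : TwoQubitOp} {u v w z : Fin 3 → ℝ} (hu : u ⬝ᵥ u = 1)
    (hv : v ⬝ᵥ v = 1) (huv : u ⬝ᵥ v = 0) (hw : w ⬝ᵥ w = 1) (hz : z ⬝ᵥ z = 1) {I J : ℝ}
    (hI : (τ * (sigma u ⊗ₖ sigma w)).trace = I) (hJ : (τ * (sigma v ⊗ₖ sigma z)).trace = J)
    (hI0 : 0 < I) (hJ0 : 0 < J) (hIJ : 1 < I ^ 2 + J ^ 2) {n : ℕ} (hn : 1 ≤ n) :
    IsNetworkNonlocal (sources n τ) := by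
  obtain ⟨n, rfl⟩ : ∃ k, n = k + 1 := ⟨n - 1, by omega⟩
  set R := √(I ^ 2 + J ^ 2) with hR
  have hR2 : R ^ 2 = I ^ 2 + J ^ 2 := Real.sq_sqrt (by positivity)
  have hR0 : 0 < R := Real.sqrt_pos.mpr (by positivity)
  have hR1 : 1 < R := by rw [hR, Real.lt_sqrt (by norm_num)]; linarith
  have hunit : (I / R) ^ 2 + (J / R) ^ 2 = 1 := by
    rw [div_pow, div_pow, ← add_div, ← hR2, div_self (by positivity)]
  have hsum : I / R * I + J / R * J = R := by
    field_simp; linarith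
  -- Measuring along `(I, J) / R` makes the first source contribute `I²/R` and `J²/R`, whose sum `R`
  -- is the largest attainable by such a rotation.
  obtain ⟨c, s, hc, hs, hcs, hlt⟩ := exists_angle_rpow (I := I / R * I) (J := J / R * J)
    (by positivity) (by positivity) (by rw [hsum]; exact hR1) n
  have hex : (![1, 0, 0] : Fin 3 → ℝ) ⬝ᵥ ![1, 0, 0] = 1 := by simp [dotProduct, Fin.sum_univ_three]
  have hez : (![0, 0, 1] : Fin 3 → ℝ) ⬝ᵥ ![0, 0, 1] = 1 := by simp [dotProduct, Fin.sum_univ_three]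
  have hzx : (![0, 0, 1] : Fin 3 → ℝ) ⬝ᵥ ![1, 0, 0] = 0 := by simp [dotProduct, Fin.sum_univ_three]
  refine isNetworkNonlocal_of_involutions (sources (n + 1) τ)
    (Fin.cons (rotatedSigma (I / R) (J / R) u v)
      fun _ => rotatedSigma c s ![0, 0, 1] ![1, 0, 0])
    (Fin.cons ![sigma w, sigma z] fun _ => ![sigma ![0, 0, 1], sigma ![1, 0, 0]]) hn ?_ ?_
    (Fin.cons (I / R * I) fun _ => c) (Fin.cons (J / R * J) fun _ => s) ?_ ?_ ?_
  · refine Fin.cases ?_ fun _ => ?_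
    · exact rotatedSigma_involution hunit hu hv huv
    · exact rotatedSigma_involution hcs hez hex hzx
  · refine Fin.cases ?_ fun _ => ?_
    · exact Fin.forall_fin_two.mpr ⟨⟨sigma_conjTranspose w, sigma_mul_self hw⟩,
        ⟨sigma_conjTranspose z, sigma_mul_self hz⟩⟩
    · exact Fin.forall_fin_two.mpr ⟨⟨sigma_conjTranspose _, sigma_mul_self hez⟩,
        ⟨sigma_conjTranspose _, sigma_mul_self hex⟩⟩
  · refine Fin.cases ?_ fun _ => ?_
    · simp only [Fin.cons_zero, half_rotatedSigma_add, smul_kronecker, mul_smul_comm, trace_smul]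
      simp [sources, hI]
    · simp only [Fin.cons_succ, half_rotatedSigma_add, smul_kronecker, mul_smul_comm, trace_smul]
      simp [sources, trace_bellState_mul_sigma_z]
  · refine Fin.cases ?_ fun _ => ?_
    · simp only [Fin.cons_zero, half_rotatedSigma_sub, smul_kronecker, mul_smul_comm, trace_smul]
      simp [sources, hJ]
    · simp only [Fin.cons_succ, half_rotatedSigma_sub, smul_kronecker, mul_smul_comm, trace_smul]
      simp [sources, trace_bellState_mul_sigma_x]
  · simp only [Fin.prod_univ_succ, Fin.cons_zero, Fin.cons_succ, Finset.prod_const,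
      Finset.card_univ, Fintype.card_fin]
    rwa [abs_of_pos (by positivity), abs_of_pos (by positivity)]

/-- The image of a left singular vector is, up to the singular value, a unit vector that attains
the correlation given by the singular value. -/
theorem exists_unit_of_left_singular {M : Matrix (Fin 3) (Fin 3) ℝ} {u : Fin 3 → ℝ} {d : ℝ}
    (hd : 0 < d) (hu : u ⬝ᵥ u = 1) (h : (M * Mᵀ) *ᵥ u = (d ^ 2) • u) :
    ∃ w : Fin 3 → ℝ, w ⬝ᵥ w = 1 ∧ u ⬝ᵥ (M *ᵥ w) = d := by
  have h1 : u ⬝ᵥ (M *ᵥ (Mᵀ *ᵥ u)) = d ^ 2 := by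
    rw [mulVec_mulVec, h, dotProduct_smul, hu, smul_eq_mul, mul_one]
  have h2 : (Mᵀ *ᵥ u) ⬝ᵥ (Mᵀ *ᵥ u) = d ^ 2 := by
    rw [← h1, dotProduct_mulVec u, mulVec_transpose]
  refine ⟨d⁻¹ • Mᵀ *ᵥ u, ?_, ?_⟩
  · rw [smul_dotProduct, dotProduct_smul, h2, smul_eq_mul, smul_eq_mul]
    field_simp
  · rw [mulVec_smul, dotProduct_smul, h1, smul_eq_mul]
    field_simp

/-- The last inequality is what `(1 - mγ²)² + ε² > 1` needs: the square is at least `1 - 2mγ²`. -/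
theorem exists_small_sharpness (m : ℕ) {ε : ℝ} (hε : 0 < ε) :
    ∃ γ : ℝ, 0 < γ ∧ γ < 1 ∧ m * γ ^ 2 < 1 ∧ 2 * (m * γ ^ 2) < ε ^ 2 := by
  have hm : (0 : ℝ) < m + 1 := by positivity
  set δ := min (1 / 2) (ε ^ 2 / 4) with hδ
  have hδ0 : 0 < δ := lt_min (by norm_num) (by positivity)
  have hδ1 : δ ≤ 1 / 2 := min_le_left _ _
  have hδ2 : δ ≤ ε ^ 2 / 4 := min_le_right _ _
  have hγ0 : 0 < δ / (m + 1) := by positivity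
  have hγ : (m + 1) * (δ / (m + 1)) = δ := by field_simp
  have hγ1 : δ / (m + 1) ≤ δ := div_le_self hδ0.le (by linarith [Nat.cast_nonneg (α := ℝ) m])
  have hle : m * (δ / (m + 1)) ^ 2 ≤ δ := by
    have h1 : (δ / (m + 1)) ^ 2 ≤ δ / (m + 1) := by nlinarith
    have h2 : (m : ℝ) * (δ / (m + 1)) ^ 2 ≤ m * (δ / (m + 1)) :=
      mul_le_mul_of_nonneg_left h1 (Nat.cast_nonneg m)
    linarith
  exact ⟨δ / (m + 1), hγ0, by linarith, by linarith, by nlinarith [sq_pos_of_pos hε]⟩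

end StarNetwork

end

theorem theorem5 (ρ : StarNetwork.TwoQubitOp) (hρ : StarNetwork.IsState ρ)
    (h : (StarNetwork.IsPure ρ ∧ StarNetwork.IsEntangled ρ) ∨
      (StarNetwork.delta ρ 0 = 1 ∧ 0 < StarNetwork.delta ρ 1)) :
    (∃ u v : Fin 3 → ℝ, StarNetwork.IsCorrFrame ρ u v) ∧
    ∀ u v : Fin 3 → ℝ, StarNetwork.IsCorrFrame ρ u v →
      ∀ θ : ℝ, 0 < θ → θ ≤ Real.pi / 4 → ∀ m : ℕ,
        ∃ γ : ℕ → ℝ, (∀ k, 0 < γ k ∧ γ k < 1) ∧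
          ∀ n : ℕ, 1 ≤ n → ∀ k : ℕ, 1 ≤ k → k ≤ m →
            StarNetwork.IsNetworkNonlocal
              (StarNetwork.sources n
                (StarNetwork.stateAfter (fun j => StarNetwork.seqPOVM u v θ (γ j)) ρ (k - 1))) := by
  obtain ⟨h0, h1⟩ : 1 ≤ StarNetwork.delta ρ 0 ∧ 0 < StarNetwork.delta ρ 1 := by
    rcases h with ⟨hp, he⟩ | ⟨h0, h1⟩
    · exact StarNetwork.delta_of_pure_entangled hp he
    · exact ⟨h0.ge, h1⟩
  have h0' : 0 < StarNetwork.delta ρ 0 := one_pos.trans_le h0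
  refine ⟨StarNetwork.exists_isCorrFrame h0' h1, ?_⟩
  intro u v ⟨hu, hv, huv, hMu, hMv⟩ θ hθ hθ4 m
  have hpi := Real.pi_pos
  have hs : 0 < Real.sin θ := Real.sin_pos_of_pos_of_lt_pi hθ (by linarith)
  have hc : 0 < Real.cos θ := Real.cos_pos_of_mem_Ioo ⟨by linarith, by linarith⟩
  have hs2 : Real.sin θ ^ 2 ≤ 1 := Real.sin_sq_le_one θ
  -- This lower bound for `J`, valid at every stage up to `m`, is fixed before `γ` is chosen.
  have hε : 0 < (Real.sin θ ^ 2) ^ m * StarNetwork.delta ρ 1 := by positivity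
  obtain ⟨γ, hγ0, hγ1, hm1, hm2⟩ := StarNetwork.exists_small_sharpness m hε
  refine ⟨fun _ => γ, fun _ => ⟨hγ0, hγ1⟩, fun n hn k _ hkm => ?_⟩
  obtain ⟨κ, μ, hκ, hμ, hκ1, hμ1⟩ :=
    StarNetwork.exists_dualStep_seqPOVM hu hv huv hc hγ0 hγ1
  obtain ⟨w, hw, hwd⟩ := StarNetwork.exists_unit_of_left_singular h0' hu hMu
  obtain ⟨z, hz, hzd⟩ := StarNetwork.exists_unit_of_left_singular h1 hv hMv
  have hherm : ρᴴ = ρ := hρ.1.isHermitian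
  have hkm' : k - 1 ≤ m := by omega
  have hI : 1 - m * γ ^ 2 ≤ κ ^ (k - 1) * StarNetwork.delta ρ 0 := by
    have hb : 1 - m * γ ^ 2 ≤ (1 - γ ^ 2) ^ (k - 1) := by
      -- Bernoulli's inequality: the loss in the `σ_u` correlation is at most linear in the number
      -- `k - 1` of preceding measurements.
      have := one_add_mul_le_pow (a := -γ ^ 2) (by nlinarith) (k - 1)
      have hc' : ((k - 1 : ℕ) : ℝ) ≤ m := by exact_mod_cast hkm'
      rw [← sub_eq_add_neg] at this
      nlinarith [sq_nonneg γ]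
    have hb2 : (1 - γ ^ 2) ^ (k - 1) ≤ κ ^ (k - 1) :=
      pow_le_pow_left₀ (by nlinarith) hκ1 _
    nlinarith
  have hJ : (Real.sin θ ^ 2) ^ m * StarNetwork.delta ρ 1 ≤
      μ ^ (k - 1) * StarNetwork.delta ρ 1 := by
    refine mul_le_mul_of_nonneg_right ?_ h1.le
    exact (pow_le_pow_of_le_one (sq_nonneg _) hs2 hkm').trans
      (pow_le_pow_left₀ (sq_nonneg _) hμ1 _)
  refine StarNetwork.isNetworkNonlocal_sources hu hv huv hw hz
    (I := κ ^ (k - 1) * StarNetwork.delta ρ 0) (J := μ ^ (k - 1) * StarNetwork.delta ρ 1)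
    ?_ ?_ (by linarith) (by linarith) ?_ hn
  · rw [StarNetwork.trace_stateAfter_mul (fun _ => hκ), StarNetwork.trace_mul_sigma_kronecker hherm,
      hwd]
    push_cast
    rfl
  · rw [StarNetwork.trace_stateAfter_mul (fun _ => hμ), StarNetwork.trace_mul_sigma_kronecker hherm,
      hzd]
    push_cast
    rfl
  · have e1 := pow_le_pow_left₀ (by linarith) hI 2
    have e2 := pow_le_pow_left₀ hε.le hJ 2
    nlinarith [sq_nonneg (m * γ ^ 2 : ℝ)]
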